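/- Fix a finite set $\mathcal A$ of agents and a countable set of propositional variables. A coalition is a subset $C\subseteq\mathcal A$. Formulae are given by the grammar $$\varphi ::= p \mid \neg\varphi \mid \varphi\to\varphi \mid \mathsf K_C\varphi \mid \mathsf S_C\varphi \mid \mathsf H_C\varphi ,$$ where $p$ is a propositional variable and $C$ a coalition; $\bot$ stands for $\neg(p_0\to p_0)$ for a fixed propositional variable $p_0$. An epistemic transition system is a tuple $(W,\{\sim_a\}_{a\in\mathcal A},V,M,\pi)$, where $W$ is a set of states, each $\sim_a$ is an equivalence relation on $W$, $V$ is a nonempty set of choices, $M\subseteq W\times V^{\mathcal A}\times W$ is such that for all $w\in W$ and $\mathbf s\in V^{\mathcal A}$ there is $w'\in W$ with $(w,\mathbf s,w')\in M$, and $\pi$ maps propositional variables to subsets of $W$. Write $w\sim_C w'$ if $w\sim_a w'$ for all $a\in C$. For $\mathbf s\in V^C$ write $w\to_{\mathbf s}u$ if $(w,\mathbf s',u)\in M$ for some $\mathbf s'\in V^{\mathcal A}$ with $s'_a=s_a$ for all $a\in C$. Satisfaction $w\Vdash\varphi$ is defined by: - $w\Vdash p$ iff $w\in\pi(p)$; $w\Vdash\neg\varphi$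 iff $w\nVdash\varphi$; $w\Vdash\varphi\to\psi$ iff $w\nVdash\varphi$ or $w\Vdash\psi$; - $w\Vdash\mathsf K_C\varphi$ iff $w'\Vdash\varphi$ for every $w'$ with $w\sim_C w'$; - $w\Vdash\mathsf S_C\varphi$ iff there is $\mathbf s\in V^C$ such that $w'\Vdash\varphi$ for every $w'$ with $w\to_{\mathbf s}w'$; - $w\Vdash\mathsf H_C\varphi$ iff there is $\mathbf s\in V^C$ such that $w''\Vdash\varphi$ for all $w',w''$ with $w\sim_C w'$ and $w'\to_{\mathbf s}w''$. Write $\vdash\varphi$ if $\varphi$ is derivable from all propositional tautologies in this language and all instances of the axioms 1. Truth: $\mathsf K_C\varphi\to\varphi$; 2. Negative Introspection: $\neg\mathsf K_C\varphi\to\mathsf K_C\neg\mathsf K_C\varphi$; 3. Distributivity: $\mathsf K_C(\varphi\to\psi)\to(\mathsf K_C\varphi\to\mathsf K_C\psi)$; 4. Monotonicity: $\mathsf K_C\varphi\to\mathsf K_D\varphi$, if $C\subseteq D$; 5. Cooperation: $\mathsf S_C(\varphi\to\psi)\to(\mathsf S_D\varphi\to\mathsf S_{C\cup D}\psi)$,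 if $C\cap D=\varnothing$; 6. Strategic Negative Introspection: $\neg\mathsf H_C\varphi\to\mathsf K_C\neg\mathsf H_C\varphi$; 7. Epistemic Cooperation: $\mathsf H_C(\varphi\to\psi)\to(\mathsf H_D\varphi\to\mathsf H_{C\cup D}\psi)$, if $C\cap D=\varnothing$; 8. Strategic Truth: $\mathsf H_C\varphi\to\mathsf S_C\varphi$; 9. Epistemic Determinicity: $\mathsf H_C(\varphi\to\psi)\to(\mathsf K_C\mathsf S_\varnothing\varphi\to\mathsf H_C\psi)$; 10. Empty Coalition: $\mathsf K_\varnothing\varphi\to\mathsf H_\varnothing\varphi$; 11. Nontermination: $\neg\mathsf S_C\bot$ by the rules Necessitation (from $\varphi$ infer $\mathsf K_C\varphi$), Strategic Necessitation (from $\varphi$ infer $\mathsf H_C\varphi$) and Modus Ponens (from $\varphi$ and $\varphi\to\psi$ infer $\psi$). Theorem (soundness and completeness). For every formula $\varphi$: $\vdash\varphi$ if and only if $w\Vdash\varphi$ for every state $w$ of every epistemic transition system. -/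

import Mathlib

universe u v w x

namespace KnowHow

/-- A coalition is a set of agents. -/
abbrev Coalition (A : Type u) : Type u := Set A

/-- The trimodal language over agents `A` and propositional variables `P`:
`know C φ` is `K_C φ`, `strat C φ` is `S_C φ`, `knowHow C φ` is `H_C φ`. -/
inductive Formula (A : Type u) (P : Type v) : Type (max u v)
  | var (p : P) : Formula A P
  | neg (φ : Formula A P) : Formula A P
  | imp (φ ψ : Formula A P) : Formula A P
  | know (C : Coalition A) (φ : Formula A P) : Formula A P
  | strat (C : Coalition A) (φ : Formula A P) : Formula A P
  | knowHow (C : Coalition A) (φ : Formula A P) : Formula A P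

namespace Formula

variable {A : Type u} {P : Type v}

/-- Falsity, as the negation of the tautology `p → p`. -/
def bot (p : P) : Formula A P := neg (imp (var p) (var p))

/-- Truth-functional evaluation: variables and formulas that begin with a modality are treated as
atoms, whose truth values are given by `b`. -/
def eval (b : Formula A P → Prop) : Formula A P → Prop
  | neg φ => ¬ eval b φ
  | imp φ ψ => eval b φ → eval b ψ
  | var p => b (var p)
  | know C φ => b (know C φ)
  | strat C φ => b (strat C φ)
  | knowHow C φ => b (knowHow C φ)

/-- Propositional tautologies in the trimodal language. -/
def IsTautology (φ : Formula A P) : Prop := ∀ b : Formula A P → Prop, eval b φ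

end Formula

/-- Epistemic transition systems. -/
structure TransitionSystem (A : Type u) (P : Type v) where
  /-- epistemic states -/
  W : Type w
  /-- indistinguishability for each agent -/
  indist : A → W → W → Prop
  indist_equivalence : ∀ a, Equivalence (indist a)
  /-- domain of choices -/
  V : Type x
  nonempty_V : Nonempty V
  /-- aggregation mechanism -/
  M : Set (W × (A → V) × W)
  /-- the system never halts -/
  total : ∀ (s : W) (f : A → V), ∃ s' : W, (s, f, s') ∈ M
  /-- valuation of the propositional variables -/
  val : P → Set W

namespace TransitionSystem

variable {A : Type u} {P : Type v}

/-- `s ∼_C t`: indistinguishability by every member of the coalition `C`. -/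
def CoalIndist (T : TransitionSystem.{u, v, w, x} A P) (C : Coalition A) (s t : T.W) : Prop :=
  ∀ a ∈ C, T.indist a s t

/-- Strategy profiles of the coalition `C`, the elements of `V^C`. -/
abbrev Profile (T : TransitionSystem.{u, v, w, x} A P) (C : Coalition A) : Type (max u x) :=
  {a : A // a ∈ C} → T.V

/-- There is a transition from `s` to `t` consistent with the strategy profile `f` of `C`. -/
def Step (T : TransitionSystem.{u, v, w, x} A P) {C : Coalition A} (f : T.Profile C)
    (s t : T.W) : Prop :=
  ∃ g : A → T.V, (∀ a : {a : A // a ∈ C}, g a.1 = f a) ∧ (s, g, t) ∈ T.M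

/-- Satisfaction of a formula at a state. -/
def Sat (T : TransitionSystem.{u, v, w, x} A P) : T.W → Formula A P → Prop
  | s, .var p => s ∈ T.val p
  | s, .neg φ => ¬ T.Sat s φ
  | s, .imp φ ψ => ¬ T.Sat s φ ∨ T.Sat s ψ
  | s, .know C φ => ∀ t, T.CoalIndist C s t → T.Sat t φ
  | s, .strat C φ => ∃ f : T.Profile C, ∀ t, T.Step f s t → T.Sat t φ
  | s, .knowHow C φ =>
      ∃ f : T.Profile C, ∀ t t', T.CoalIndist C s t → T.Step f t t' → T.Sat t' φ

end TransitionSystem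

open Formula in
/-- `Provable p₀ φ`: the formula `φ` is a theorem of the trimodal system, where falsity is
`¬ (p₀ → p₀)` for the fixed propositional variable `p₀`. -/
inductive Provable {A : Type u} {P : Type v} (p₀ : P) : Formula A P → Prop
  | tautology (φ : Formula A P) : IsTautology φ → Provable p₀ φ
  | truth (C : Coalition A) (φ : Formula A P) :
      Provable p₀ (imp (know C φ) φ)
  | negative_introspection (C : Coalition A) (φ : Formula A P) :
      Provable p₀ (imp (neg (know C φ)) (know C (neg (know C φ))))
  | distributivity (C : Coalition A) (φ ψ : Formula A P) :
      Provable p₀ (imp (know C (imp φ ψ)) (imp (know C φ) (know C ψ)))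
  | monotonicity (C D : Coalition A) (φ : Formula A P) : C ⊆ D →
      Provable p₀ (imp (know C φ) (know D φ))
  | cooperation (C D : Coalition A) (φ ψ : Formula A P) : C ∩ D = ∅ →
      Provable p₀ (imp (strat C (imp φ ψ)) (imp (strat D φ) (strat (C ∪ D) ψ)))
  | strategic_negative_introspection (C : Coalition A) (φ : Formula A P) :
      Provable p₀ (imp (neg (knowHow C φ)) (know C (neg (knowHow C φ))))
  | epistemic_cooperation (C D : Coalition A) (φ ψ : Formula A P) : C ∩ D = ∅ →
      Provable p₀ (imp (knowHow C (imp φ ψ)) (imp (knowHow D φ) (knowHow (C ∪ D) ψ)))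
  | strategic_truth (C : Coalition A) (φ : Formula A P) :
      Provable p₀ (imp (knowHow C φ) (strat C φ))
  | epistemic_determinicity (C : Coalition A) (φ ψ : Formula A P) :
      Provable p₀ (imp (knowHow C (imp φ ψ)) (imp (know C (strat ∅ φ)) (knowHow C ψ)))
  | empty_coalition (φ : Formula A P) :
      Provable p₀ (imp (know ∅ φ) (knowHow ∅ φ))
  | nontermination (C : Coalition A) :
      Provable p₀ (neg (strat C (bot p₀)))
  | necessitation (C : Coalition A) (φ : Formula A P) :
      Provable p₀ φ → Provable p₀ (know C φ)
  | strategic_necessitation (C : Coalition A) (φ : Formula A P) :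
      Provable p₀ φ → Provable p₀ (knowHow C φ)
  | modus_ponens (φ ψ : Formula A P) :
      Provable p₀ φ → Provable p₀ (imp φ ψ) → Provable p₀ ψ

end KnowHow

/-! Soundness is an induction on derivations. Completeness uses a canonical model that must get
joint knowledge and know-how right at once.

Joint knowledge: maximal consistent sets that agree on what each member of `C` knows may still
differ on what `C` knows jointly. So states are paths in a tree whose edges carry coalitions, and an
agent confuses states joined by edges that contain the agent. Tree paths are unique, so states
confused by every member of `C` are joined by edges that contain all of `C` (`origin_eq_of_forall`),
and along these `know C φ` and `knowHow C φ` keep their truth value.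

Strategies: every agent votes for a formula and names a tag. If `D` voted for `ψ`, then `knowHow D
ψ` enforces `ψ`, while `strat D ψ` does so only if `D` also named the tag of the present state.
Hence `strat C φ` does not by itself yield know-how: states reached by `C`-edges with different tags
look alike to `C`, and at a tag that nobody named only `strat ∅` and know-how still take effect.
Epistemic Determinicity says that these do not suffice to force `φ` when `knowHow C φ` fails
(`exists_of_knowHow_notMem`). The truth lemma is `sat_canonicalModel_iff`. -/

namespace KnowHow

open Formula

/-! ### Soundness -/

section Soundness

variable {A : Type u} {P : Type v}

namespace TransitionSystem

variable (T : TransitionSystem.{u, v, w, x} A P)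

/-- Gives soundness of tautologies: satisfaction at a fixed state is a truth assignment. -/
theorem sat_iff_eval (s : T.W) (φ : Formula A P) : T.Sat s φ ↔ eval (T.Sat s) φ := by
  induction φ with
  | neg φ ih => simp only [Sat, eval, ih]
  | imp φ ψ ihφ ihψ => simp only [Sat, eval, ihφ, ihψ, imp_iff_not_or]
  | _ => rfl

theorem sat_imp {s : T.W} {φ ψ : Formula A P} :
    T.Sat s (imp φ ψ) ↔ (T.Sat s φ → T.Sat s ψ) := by
  simp only [Sat, imp_iff_not_or]

theorem coalIndist_refl (C : Coalition A) (s : T.W) : T.CoalIndist C s s :=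
  fun a _ => (T.indist_equivalence a).refl s

variable {T} in
theorem CoalIndist.symm {C : Coalition A} {s t : T.W} (h : T.CoalIndist C s t) :
    T.CoalIndist C t s :=
  fun a ha => (T.indist_equivalence a).symm (h a ha)

variable {T} in
theorem CoalIndist.trans {C : Coalition A} {s t r : T.W} (h : T.CoalIndist C s t)
    (h' : T.CoalIndist C t r) : T.CoalIndist C s r :=
  fun a ha => (T.indist_equivalence a).trans (h a ha) (h' a ha)

variable {T} in
theorem Step.restrict {C D : Coalition A} (hCD : C ⊆ D) {f : T.Profile D} {s t : T.W}
    (h : T.Step f s t) : T.Step (fun a : {a : A // a ∈ C} => f ⟨a.1, hCD a.2⟩) s t := by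
  obtain ⟨g, hg, hM⟩ := h
  exact ⟨g, fun a => hg ⟨a.1, hCD a.2⟩, hM⟩

/-- Every profile of a coalition can be followed at every state. -/
theorem exists_step {C : Coalition A} (f : T.Profile C) (s : T.W) : ∃ t, T.Step f s t := by
  classical
  obtain ⟨v⟩ := T.nonempty_V
  obtain ⟨t, ht⟩ := T.total s (fun a => if h : a ∈ C then f ⟨a, h⟩ else v)
  exact ⟨t, _, fun a => by simp [a.2], ht⟩

/-- Profiles of disjoint coalitions have a common extension to the union. -/
theorem exists_union_profile {C D : Coalition A} (hCD : C ∩ D = ∅) (f : T.Profile C)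
    (g : T.Profile D) : ∃ h : T.Profile (C ∪ D), ∀ s t, T.Step h s t → T.Step f s t ∧ T.Step g s t := by
  classical
  refine ⟨fun a => if h : a.1 ∈ C then f ⟨a.1, h⟩ else g ⟨a.1, a.2.resolve_left h⟩, ?_⟩
  intro s t hst
  have hf := hst.restrict (Set.subset_union_left (s := C) (t := D))
  have hg := hst.restrict (Set.subset_union_right (s := C) (t := D))
  constructor
  · convert hf using 2 with a
    simp [a.2]
  · convert hg using 2 with a
    have : a.1 ∉ C := fun h => Set.eq_empty_iff_forall_notMem.1 hCD a.1 ⟨h, a.2⟩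
    simp [this]

end TransitionSystem

theorem Provable.sound {p₀ : P} {φ : Formula A P} (h : Provable p₀ φ) :
    ∀ (T : TransitionSystem.{u, v, w, x} A P) (s : T.W), T.Sat s φ := by
  intro T
  induction h with
  | tautology φ h => exact fun s => (T.sat_iff_eval s φ).2 (h _)
  | truth C φ => exact fun s => T.sat_imp.2 fun h => h s (T.coalIndist_refl C s)
  | negative_introspection C φ =>
      exact fun s => T.sat_imp.2 fun h t ht h' => h fun r hr => h' r (ht.symm.trans hr)
  | distributivity C φ ψ =>
      exact fun s => T.sat_imp.2 fun h => T.sat_imp.2 fun h' t ht =>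
        T.sat_imp.1 (h t ht) (h' t ht)
  | monotonicity C D φ hCD =>
      exact fun s => T.sat_imp.2 fun h t ht => h t fun a ha => ht a (hCD ha)
  | cooperation C D φ ψ hCD =>
      refine fun s => T.sat_imp.2 fun ⟨f, hf⟩ => T.sat_imp.2 fun ⟨g, hg⟩ => ?_
      obtain ⟨h, hh⟩ := T.exists_union_profile hCD f g
      exact ⟨h, fun t ht => T.sat_imp.1 (hf t (hh s t ht).1) (hg t (hh s t ht).2)⟩
  | strategic_negative_introspection C φ =>
      exact fun s => T.sat_imp.2 fun h t ht ⟨f, hf⟩ =>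
        h ⟨f, fun r r' hr => hf r r' (ht.symm.trans hr)⟩
  | epistemic_cooperation C D φ ψ hCD =>
      refine fun s => T.sat_imp.2 fun ⟨f, hf⟩ => T.sat_imp.2 fun ⟨g, hg⟩ => ?_
      obtain ⟨h, hh⟩ := T.exists_union_profile hCD f g
      exact ⟨h, fun t t' hst ht => T.sat_imp.1
        (hf t t' (fun a ha => hst a (.inl ha)) (hh t t' ht).1)
        (hg t t' (fun a ha => hst a (.inr ha)) (hh t t' ht).2)⟩
  | strategic_truth C φ =>
      exact fun s => T.sat_imp.2 fun ⟨f, hf⟩ => ⟨f, fun t => hf s t (T.coalIndist_refl C s)⟩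
  | epistemic_determinicity C φ ψ =>
      refine fun s => T.sat_imp.2 fun ⟨f, hf⟩ => T.sat_imp.2 fun h => ⟨f, fun t t' hst ht => ?_⟩
      obtain ⟨e, he⟩ := h t hst
      obtain ⟨g, _, hg⟩ := id ht
      -- The empty profile constrains nothing, so `he` applies to every transition from `t`.
      exact T.sat_imp.1 (hf t t' hst ht) (he t' ⟨g, fun a => a.2.elim, hg⟩)
  | empty_coalition φ =>
      exact fun s => T.sat_imp.2 fun h =>
        ⟨fun a => a.2.elim, fun t t' _ _ => h t' fun a ha => ha.elim⟩
  | nontermination C =>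
      rintro s ⟨f, hf⟩
      obtain ⟨t, ht⟩ := T.exists_step f s
      exact hf t ht (T.sat_imp.2 id)
  | necessitation C φ _ ih => exact fun s t _ => ih t
  | strategic_necessitation C φ _ ih =>
      obtain ⟨v⟩ := T.nonempty_V
      exact fun s => ⟨fun _ => v, fun _ t' _ _ => ih t'⟩
  | modus_ponens φ ψ _ _ ihφ ihψ => exact fun s => T.sat_imp.1 (ihψ s) (ihφ s)

end Soundness

/-! ### Derivations and maximal consistent sets -/

section Derivations

variable {A : Type u} {P : Type v} {p₀ : P}

/-- Derivability from hypotheses, by Modus Ponens alone. -/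
inductive Derives (p₀ : P) (Γ : Set (Formula A P)) : Formula A P → Prop
  | hyp (φ : Formula A P) : φ ∈ Γ → Derives p₀ Γ φ
  | thm (φ : Formula A P) : Provable p₀ φ → Derives p₀ Γ φ
  | mp (φ ψ : Formula A P) : Derives p₀ Γ φ → Derives p₀ Γ (imp φ ψ) → Derives p₀ Γ ψ

theorem provable_imp_self (p₀ : P) (φ : Formula A P) : Provable p₀ (imp φ φ) :=
  .tautology _ fun _ h => h

namespace Derives

variable {Γ Δ : Set (Formula A P)} {φ ψ : Formula A P}

theorem mono (h : Derives p₀ Γ φ) (hΓ : Γ ⊆ Δ) : Derives p₀ Δ φ := by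
  induction h with
  | hyp φ h => exact .hyp _ (hΓ h)
  | thm φ h => exact .thm _ h
  | mp φ ψ _ _ ihφ ihψ => exact .mp _ _ ihφ ihψ

theorem taut_imp (h : Derives p₀ Γ φ) (ht : IsTautology (imp φ ψ)) : Derives p₀ Γ ψ :=
  .mp _ _ h (.thm _ (.tautology _ ht))

theorem provable (h : Derives p₀ (∅ : Set (Formula A P)) φ) : Provable p₀ φ := by
  induction h with
  | hyp φ h => exact h.elim
  | thm φ h => exact h
  | mp φ ψ _ _ ihφ ihψ => exact .modus_ponens _ _ ihφ ihψ

theorem deduction (h : Derives p₀ (insert ψ Γ) φ) : Derives p₀ Γ (imp ψ φ) := by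
  induction h with
  | hyp φ h =>
      rcases h with rfl | h
      · exact .thm _ (provable_imp_self _ _)
      · exact taut_imp (.hyp _ h) fun _ h _ => h
  | thm φ h => exact taut_imp (.thm _ h) fun _ h _ => h
  | mp φ χ _ _ ihφ ihχ =>
      exact .mp _ _ ihχ (taut_imp ihφ fun _ h₁ h₂ h => h₂ h (h₁ h))

theorem of_imp (h : Derives p₀ Γ (imp ψ φ)) : Derives p₀ (insert ψ Γ) φ :=
  .mp _ _ (.hyp _ (Set.mem_insert _ _)) (h.mono (Set.subset_insert _ _))

theorem compact (h : Derives p₀ Γ φ) :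
    ∃ s : Finset (Formula A P), ↑s ⊆ Γ ∧ Derives p₀ (↑s : Set (Formula A P)) φ := by
  classical
  induction h with
  | hyp φ h => exact ⟨{φ}, by simpa using h, .hyp _ (by simp)⟩
  | thm φ h => exact ⟨∅, by simp, .thm _ h⟩
  | mp φ ψ _ _ ihφ ihψ =>
      obtain ⟨s, hs, hs'⟩ := ihφ
      obtain ⟨t, ht, ht'⟩ := ihψ
      refine ⟨s ∪ t, by simp [hs, ht], .mp φ _ (hs'.mono ?_) (ht'.mono ?_)⟩ <;> simp

/-- Finitely many hypotheses can be moved into the conclusion. -/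
theorem exists_discharge (p₀ : P) (s : Finset (Formula A P)) (φ : Formula A P) :
    ∃ α : Formula A P, ∀ Γ : Set (Formula A P), Derives p₀ (Γ ∪ ↑s) φ ↔ Derives p₀ Γ α := by
  classical
  induction s using Finset.induction_on with
  | empty => exact ⟨φ, fun Γ => by simp⟩
  | insert ψ s _ ih =>
      obtain ⟨α, hα⟩ := ih
      refine ⟨imp ψ α, fun Γ => ?_⟩
      have : Γ ∪ ↑(insert ψ s) = insert ψ Γ ∪ ↑s := by
        ext; simp; tauto
      rw [this, hα]
      exact ⟨deduction, of_imp⟩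

end Derives

/-- Deductively closed, consistent and negation-complete sets of formulas. -/
structure IsMaximalConsistent (p₀ : P) (X : Set (Formula A P)) : Prop where
  closed : ∀ φ, Derives p₀ X φ → φ ∈ X
  neg_mem_iff : ∀ φ, neg φ ∈ X ↔ φ ∉ X

/-- Lindenbaum's lemma. -/
theorem exists_isMaximalConsistent {Γ : Set (Formula A P)} {φ : Formula A P}
    (h : ¬ Derives p₀ Γ φ) : ∃ X, IsMaximalConsistent p₀ X ∧ Γ ⊆ X ∧ φ ∉ X := by
  obtain ⟨X, hΓX, hX⟩ := zorn_subset_nonempty {Δ : Set (Formula A P) | ¬ Derives p₀ Δ φ} (by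
    intro c hc hchain hne
    refine ⟨⋃₀ c, fun hd => ?_, fun s hs => Set.subset_sUnion_of_mem hs⟩
    obtain ⟨s, hs, hd⟩ := hd.compact
    obtain ⟨t, ht, hst⟩ := hchain.directedOn.exists_mem_subset_of_finset_subset_biUnion
      (f := id) hne (s := s) (by simpa [Set.sUnion_eq_biUnion] using hs)
    exact hc ht (hd.mono hst)) Γ h
  have hXφ : ¬ Derives p₀ X φ := hX.prop
  have hmem : ∀ ψ, ¬ Derives p₀ (insert ψ X) φ → ψ ∈ X := fun ψ hψ =>
    hX.le_of_ge hψ (Set.subset_insert ψ X) (Set.mem_insert ψ X)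
  refine ⟨X, ⟨fun ψ hψ => hmem ψ fun hd => hXφ (.mp _ _ hψ hd.deduction), fun ψ => ⟨?_, ?_⟩⟩,
    hΓX, fun h => hXφ (.hyp _ h)⟩
  · intro hn hp
    exact hXφ (.mp _ _ (.hyp _ hp) (Derives.taut_imp (.hyp _ hn) fun _ h h' => (h h').elim))
  · intro hp
    by_contra hn
    have h₁ := (not_not.1 (mt (hmem ψ) hp)).deduction
    have h₂ := (not_not.1 (mt (hmem (neg ψ)) hn)).deduction
    refine hXφ (.mp _ _ h₂ (h₁.taut_imp fun b h h' => ?_))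
    by_cases hb : eval b ψ
    · exact h hb
    · exact h' hb

namespace IsMaximalConsistent

variable {X : Set (Formula A P)} {φ ψ : Formula A P} {C D : Coalition A}

theorem of_provable (hX : IsMaximalConsistent p₀ X) (h : Provable p₀ φ) : φ ∈ X :=
  hX.closed _ (.thm _ h)

theorem mem_of_imp_mem (hX : IsMaximalConsistent p₀ X) (h : imp φ ψ ∈ X) (hφ : φ ∈ X) : ψ ∈ X :=
  hX.closed _ (.mp _ _ (.hyp _ hφ) (.hyp _ h))

theorem mp (hX : IsMaximalConsistent p₀ X) (h : Provable p₀ (imp φ ψ)) (hφ : φ ∈ X) : ψ ∈ X :=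
  hX.mem_of_imp_mem (hX.of_provable h) hφ

theorem imp_mem_iff (hX : IsMaximalConsistent p₀ X) : imp φ ψ ∈ X ↔ (φ ∉ X ∨ ψ ∈ X) := by
  constructor
  · intro h
    by_cases hφ : φ ∈ X
    · exact .inr (hX.mem_of_imp_mem h hφ)
    · exact .inl hφ
  · rintro (h | h)
    · exact hX.mp (.tautology _ fun _ h h' => (h h').elim) ((hX.neg_mem_iff _).2 h)
    · exact hX.mp (.tautology _ fun _ h _ => h) h

theorem know_mem_of_derives (hX : IsMaximalConsistent p₀ X)
    (h : Derives p₀ {χ | know C χ ∈ X} φ) : know C φ ∈ X := by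
  induction h with
  | hyp φ h => exact h
  | thm φ h => exact hX.of_provable (.necessitation _ _ h)
  | mp φ ψ _ _ ihφ ihψ =>
      exact hX.mem_of_imp_mem (hX.mp (.distributivity _ _ _) ihψ) ihφ

theorem know_mono (hX : IsMaximalConsistent p₀ X) (hCD : C ⊆ D) (h : know C φ ∈ X) :
    know D φ ∈ X :=
  hX.mp (.monotonicity _ _ _ hCD) h

theorem know_mp (hX : IsMaximalConsistent p₀ X) (h : Provable p₀ (imp φ ψ)) (hφ : know C φ ∈ X) :
    know C ψ ∈ X :=
  hX.mem_of_imp_mem (hX.mp (.distributivity _ _ _) (hX.of_provable (.necessitation _ _ h))) hφ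

/-- A formula whose negation is known as soon as it is true is itself known if true. -/
theorem know_of_negative_introspection (hX : IsMaximalConsistent p₀ X)
    (h : Provable p₀ (imp (neg φ) (know C (neg φ)))) (hφ : φ ∈ X) : know C φ ∈ X := by
  -- Since `φ` is true, its negation is not known, and this is itself known; the contrapositive of
  -- `h` then leads back to `φ` under `know C`.
  have h₁ : neg (know C (neg φ)) ∈ X := (hX.neg_mem_iff _).2 fun h' =>
    (hX.neg_mem_iff _).1 (hX.mp (.truth _ _) h') hφ
  refine hX.know_mp ?_ (hX.mp (.negative_introspection _ _) h₁)
  exact .modus_ponens _ _ h (.tautology _ fun _ h h' => by_contra fun h'' => h' (h h''))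

/-- Positive introspection. -/
theorem know_know (hX : IsMaximalConsistent p₀ X) (h : know C φ ∈ X) : know C (know C φ) ∈ X :=
  hX.know_of_negative_introspection (.negative_introspection _ _) h

theorem know_knowHow (hX : IsMaximalConsistent p₀ X) (h : knowHow C φ ∈ X) :
    know C (knowHow C φ) ∈ X :=
  hX.know_of_negative_introspection (.strategic_negative_introspection _ _) h

end IsMaximalConsistent

/-- The laws shared by the modalities `strat` and `knowHow`. -/
structure IsCooperative (p₀ : P) (op : Coalition A → Formula A P → Formula A P) : Prop where
  nec : ∀ C φ, Provable p₀ φ → Provable p₀ (op C φ)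
  coop : ∀ C D φ ψ, C ∩ D = ∅ →
    Provable p₀ (imp (op C (imp φ ψ)) (imp (op D φ) (op (C ∪ D) ψ)))

theorem isCooperative_knowHow (p₀ : P) :
    IsCooperative p₀ (knowHow : Coalition A → Formula A P → Formula A P) :=
  ⟨.strategic_necessitation, .epistemic_cooperation⟩

theorem isCooperative_strat (p₀ : P) :
    IsCooperative p₀ (strat : Coalition A → Formula A P → Formula A P) :=
  ⟨fun _ _ h => .modus_ponens _ _ (.strategic_necessitation _ _ h) (.strategic_truth _ _),
    .cooperation⟩

namespace IsCooperative

variable {op : Coalition A → Formula A P → Formula A P} {X : Set (Formula A P)}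
  {φ : Formula A P} {C D : Coalition A}

/-- The agents of `D \ C` contribute the theorem `φ → φ`, and cooperation with `C` does the rest. -/
theorem mono (hop : IsCooperative p₀ op) (hX : IsMaximalConsistent p₀ X) (hCD : C ⊆ D)
    (h : op C φ ∈ X) : op D φ ∈ X := by
  have h₁ := hX.mp (hop.coop (D \ C) C φ φ (by simp))
    (hX.of_provable (hop.nec _ _ (provable_imp_self p₀ φ)))
  have h₂ := hX.mem_of_imp_mem h₁ h
  rwa [Set.sdiff_union_of_subset hCD] at h₂

/-- The deduction theorem removes one hypothesis at a time, and cooperation restores it; `hE`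
supplies the disjointness that cooperation needs. -/
theorem mem_of_finset (hop : IsCooperative p₀ op) (hX : IsMaximalConsistent p₀ X)
    {E : Formula A P → Coalition A} (hE : ∀ ψ χ a, a ∈ E ψ → a ∈ E χ → ψ = χ)
    (s : Finset (Formula A P)) (hs : ∀ ψ ∈ s, op (E ψ) ψ ∈ X)
    (h : Derives p₀ (↑s : Set (Formula A P)) φ) : op (⋃ ψ ∈ s, E ψ) φ ∈ X := by
  classical
  induction s using Finset.induction_on generalizing φ with
  | empty =>
      exact hX.of_provable (hop.nec _ _ (Derives.provable (by simpa using h)))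
  | insert ψ s hψ ih =>
      have h₁ := ih (φ := imp ψ φ) (fun χ hχ => hs χ (Finset.mem_insert_of_mem hχ))
        (Derives.deduction (by simpa using h))
      have hdisj : (⋃ χ ∈ s, E χ) ∩ E ψ = ∅ := by
        refine Set.eq_empty_iff_forall_notMem.2 ?_
        rintro a ⟨ha, haψ⟩
        obtain ⟨χ, hχ, ha⟩ := Set.mem_iUnion₂.1 ha
        exact hψ (hE χ ψ a ha haψ ▸ hχ)
      have h₂ := hX.mem_of_imp_mem (hX.mp (hop.coop _ _ _ _ hdisj) h₁)
        (hs ψ (Finset.mem_insert_self _ _))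
      rwa [Finset.set_biUnion_insert, Set.union_comm]

/-- If pairwise disjoint parts of `C` can force formulas that jointly imply `φ`, then `C` can
force `φ`. -/
theorem mem_of_derives (hop : IsCooperative p₀ op) (hX : IsMaximalConsistent p₀ X)
    {E : Formula A P → Coalition A} (hE : ∀ ψ χ a, a ∈ E ψ → a ∈ E χ → ψ = χ)
    (hEC : ∀ ψ, E ψ ⊆ C) (h : Derives p₀ {ψ | op (E ψ) ψ ∈ X} φ) : op C φ ∈ X := by
  obtain ⟨s, hs, h⟩ := h.compact
  exact hop.mono hX (Set.iUnion₂_subset fun ψ _ => hEC ψ) (hop.mem_of_finset hX hE s hs h)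

end IsCooperative

/-! ### Witnesses for the failure of a modality -/

namespace IsMaximalConsistent

variable {X : Set (Formula A P)} {φ : Formula A P} {C : Coalition A}

theorem exists_of_know_notMem (hX : IsMaximalConsistent p₀ X) (h : know C φ ∉ X) :
    ∃ Y, IsMaximalConsistent p₀ Y ∧ {χ | know C χ ∈ X} ⊆ Y ∧ φ ∉ Y :=
  exists_isMaximalConsistent (mt hX.know_mem_of_derives h)

theorem strat_of_knowHow (hX : IsMaximalConsistent p₀ X) (h : knowHow C φ ∈ X) : strat C φ ∈ X :=
  hX.mp (.strategic_truth _ _) h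

/-- Here `s` records votes. Voters for different formulas are disjoint, so if the formulas enforced
from within `C` implied `φ`, cooperation would yield `strat C φ`. A formula with a voter outside `C`
is a theorem and lies in `Y` anyway. -/
theorem exists_of_strat_notMem (hX : IsMaximalConsistent p₀ X) (h : strat C φ ∉ X)
    (s : A → Formula A P) (hs : ∀ a ∉ C, Provable p₀ (s a)) :
    ∃ Y, IsMaximalConsistent p₀ Y ∧ (∀ ψ, strat {a | s a = ψ} ψ ∈ X → ψ ∈ Y) ∧ φ ∉ Y := by
  have hd : ¬ Derives p₀ {ψ | strat ({a | s a = ψ} ∩ C) ψ ∈ X} φ := fun hd =>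
    h ((isCooperative_strat p₀).mem_of_derives hX
      (fun ψ χ a h₁ h₂ => h₁.1.symm.trans h₂.1) (fun ψ => Set.inter_subset_right) hd)
  obtain ⟨Y, hY, hXY, hφ⟩ := exists_isMaximalConsistent hd
  refine ⟨Y, hY, fun ψ hψ => ?_, hφ⟩
  by_cases hC : {a | s a = ψ} ⊆ C
  · exact hXY (by simpa [Set.inter_eq_left.2 hC] using hψ)
  · obtain ⟨a, rfl, ha⟩ := Set.not_subset.1 hC
    exact hY.of_provable (hs a ha)

/-- Let `T` collect the formulas voted for that know-how within `C` enforces, and let `α` express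
that `T` implies `φ`. Then `C` knows how to achieve `α → φ`, so by Epistemic Determinicity `C`
cannot know `strat ∅ α`. At an epistemic alternative `X'` where `strat ∅ α` fails, the formulas
forced by `strat ∅` together with `T` do not derive `φ`. -/
theorem exists_of_knowHow_notMem [Finite A] (hX : IsMaximalConsistent p₀ X)
    (h : knowHow C φ ∉ X) (s : A → Formula A P) (hs : ∀ a ∉ C, Provable p₀ (s a)) :
    ∃ X' Y, IsMaximalConsistent p₀ X' ∧ IsMaximalConsistent p₀ Y ∧ {χ | know C χ ∈ X} ⊆ X' ∧
      (∀ ψ, strat ∅ ψ ∈ X' → ψ ∈ Y) ∧ (∀ ψ, knowHow {a | s a = ψ} ψ ∈ X' → ψ ∈ Y) ∧ φ ∉ Y := by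
  classical
  obtain ⟨T, hT⟩ : ∃ T : Finset (Formula A P), ∀ ψ,
      ψ ∈ T ↔ ψ ∈ Set.range s ∧ knowHow ({a | s a = ψ} ∩ C) ψ ∈ X :=
    ⟨((Set.finite_range s).subset
      (Set.sep_subset _ fun ψ => knowHow ({a | s a = ψ} ∩ C) ψ ∈ X)).toFinset, by simp⟩
  obtain ⟨α, hα⟩ := Derives.exists_discharge p₀ T φ
  have hK : know C (strat ∅ α) ∉ X := by
    intro hK
    have h₁ : Derives p₀ (↑T : Set (Formula A P)) (imp α φ) := by
      refine Derives.deduction ?_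
      have := (hα {α}).2 (.hyp _ rfl)
      simpa using this
    have h₂ := (isCooperative_knowHow p₀).mem_of_derives (C := C) hX
      (E := fun ψ => {a | s a = ψ} ∩ C) (fun ψ χ a h₁ h₂ => h₁.1.symm.trans h₂.1)
      (fun ψ => Set.inter_subset_right) (h₁.mono fun ψ hψ => ((hT ψ).1 hψ).2)
    exact h (hX.mem_of_imp_mem (hX.mp (.epistemic_determinicity _ _ _) h₂) hK)
  obtain ⟨X', hX', hXX', hαX'⟩ := hX.exists_of_know_notMem hK
  have hd : ¬ Derives p₀ ({ψ | strat ∅ ψ ∈ X'} ∪ ↑T) φ := fun hd =>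
    hαX' ((isCooperative_strat p₀).mem_of_derives hX' (E := fun _ => ∅)
      (fun _ _ _ h _ => h.elim) (fun _ => subset_rfl) ((hα _).1 hd))
  obtain ⟨Y, hY, hXY, hφ⟩ := exists_isMaximalConsistent hd
  have hS : ∀ ψ, strat ∅ ψ ∈ X' → ψ ∈ Y := fun ψ hψ => hXY (.inl hψ)
  refine ⟨X', Y, hX', hY, hXX', hS, fun ψ hψ => ?_, hφ⟩
  by_cases hne : ψ ∈ Set.range s
  · by_cases hC : {a | s a = ψ} ⊆ C
    · refine hXY (.inr ((hT ψ).2 ⟨hne, ?_⟩))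
      rw [Set.inter_eq_left.2 hC]
      -- All voters are in `C`, so had `X` lacked this know-how, `C` would know the lack and `X'`
      -- would inherit it.
      by_contra hn
      have h₁ := hX.mp (.strategic_negative_introspection _ _) ((hX.neg_mem_iff _).2 hn)
      exact (hX'.neg_mem_iff _).1 (hXX' (hX.know_mono hC h₁)) hψ
    · obtain ⟨a, rfl, ha⟩ := Set.not_subset.1 hC
      exact hY.of_provable (hs a ha)
  · have : {a | s a = ψ} = ∅ := Set.eq_empty_iff_forall_notMem.2 fun a ha => hne ⟨a, ha⟩
    rw [this] at hψ
    exact hS ψ (hX'.strat_of_knowHow hψ)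

end IsMaximalConsistent

end Derivations

section CanonicalModel

variable {A : Type u} {P : Type v} {p₀ : P}

/-- States of the canonical model: paths in a tree, listed from the last edge to the first. Each
edge carries a coalition, a set of formulas for its target, and a tag that distinguishes copies of
the same target. -/
abbrev Path (A : Type u) (P : Type v) : Type (max u v) :=
  List (Set A × Set (Formula A P) × ℕ)

namespace Path

open Classical in
/-- The set of formulas that hold at the end of a path which starts at `X`. An edge whose label is
not a maximal consistent set that contains what its coalition knows is treated as a loop. -/
noncomputable def label (p₀ : P) (X : Set (Formula A P)) : Path A P → Set (Formula A P)
  | [] => X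
  | (C, Y, _) :: l =>
      if IsMaximalConsistent p₀ Y ∧ {χ | know C χ ∈ label p₀ X l} ⊆ Y then Y else label p₀ X l

/-- The tag of the end of a path. -/
def tag : Path A P → ℕ
  | [] => 0
  | (_, _, n) :: _ => n

open Classical in
/-- The first state from which all members of `C` consider the given one possible. -/
noncomputable def origin (C : Set A) : Path A P → Path A P
  | [] => []
  | (D, Y, n) :: l => if C ⊆ D then origin C l else (D, Y, n) :: l

variable {X : Set (Formula A P)}

theorem isMaximalConsistent_label (hX : IsMaximalConsistent p₀ X) (l : Path A P) :
    IsMaximalConsistent p₀ (label p₀ X l) := by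
  induction l with
  | nil => exact hX
  | cons e l ih =>
      rw [label]
      split_ifs with h
      · exact h.1
      · exact ih

theorem label_cons {C : Set A} {Y : Set (Formula A P)} {n : ℕ} {l : Path A P}
    (hY : IsMaximalConsistent p₀ Y) (h : {χ | know C χ ∈ label p₀ X l} ⊆ Y) :
    label p₀ X ((C, Y, n) :: l) = Y := by
  rw [label, if_pos ⟨hY, h⟩]

theorem know_subset_label_cons (hX : IsMaximalConsistent p₀ X) (C : Set A)
    (Y : Set (Formula A P)) (n : ℕ) (l : Path A P) :
    {χ | know C χ ∈ label p₀ X l} ⊆ label p₀ X ((C, Y, n) :: l) := by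
  rw [label]
  split_ifs with h
  · exact h.2
  · exact fun χ hχ => (isMaximalConsistent_label hX l).mp (.truth _ _) hχ

/-- The larger coalition is stopped by every edge that stops the smaller one, so it moves back no
further. -/
theorem origin_suffix {C D : Set A} (h : D ⊆ C) (l : Path A P) :
    origin D l <:+ origin C l := by
  induction l with
  | nil => exact List.suffix_rfl
  | cons e l ih =>
      obtain ⟨E, Y, n⟩ := e
      by_cases hC : C ⊆ E
      · simpa [origin, hC, h.trans hC] using ih
      · by_cases hD : D ⊆ E
        · simp only [origin, if_neg hC, if_pos hD]
          refine List.IsSuffix.trans ?_ (List.suffix_cons _ l)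
          clear ih
          induction l with
          | nil => exact List.suffix_rfl
          | cons e l ih =>
              rw [origin]
              split_ifs
              · exact ih.trans (List.suffix_cons _ _)
              · exact List.suffix_rfl
        · simp [origin, hC, hD]

/-- The edge that stops `C` omits some member, who is stopped at that same edge; if no edge stops
`C`, any member will do. -/
theorem exists_origin_eq {C : Set A} (hC : C.Nonempty) (l : Path A P) :
    ∃ a ∈ C, origin {a} l = origin C l := by
  induction l with
  | nil => exact ⟨_, hC.some_mem, rfl⟩
  | cons e l ih =>
      obtain ⟨E, Y, n⟩ := e
      by_cases h : C ⊆ E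
      · obtain ⟨a, ha, hl⟩ := ih
        exact ⟨a, ha, by simp [origin, h, h ha, hl]⟩
      · obtain ⟨a, ha, haE⟩ := Set.not_subset.1 h
        exact ⟨a, ha, by simp [origin, h, haE]⟩

theorem origin_empty (l : Path A P) : origin ∅ l = [] := by
  induction l with
  | nil => rfl
  | cons e l ih => simpa [origin] using ih

/-- For each path some single member has the same origin as `C`. Comparing these members across both
paths makes each origin a suffix of the other. -/
theorem origin_eq_of_forall {C : Set A} {l m : Path A P}
    (h : ∀ a ∈ C, origin {a} l = origin {a} m) : origin C l = origin C m := by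
  rcases C.eq_empty_or_nonempty with rfl | hC
  · rw [origin_empty, origin_empty]
  obtain ⟨a, ha, hal⟩ := exists_origin_eq hC l
  obtain ⟨b, hb, hbm⟩ := exists_origin_eq hC m
  have h₁ : origin C l <:+ origin C m := by
    rw [← hal, h a ha]
    exact origin_suffix (by simpa using ha) m
  have h₂ : origin C m <:+ origin C l := by
    rw [← hbm, ← h b hb]
    exact origin_suffix (by simpa using hb) l
  exact h₁.eq_of_length_le h₂.length_le

/-- A formula that `C` knows whenever it is true, and whose negation `C` knows whenever that is
true, is constant along the edges known to `C`. -/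
theorem mem_label_origin (hX : IsMaximalConsistent p₀ X) {C : Set A} {φ : Formula A P}
    (hpos : ∀ Y, IsMaximalConsistent p₀ Y → φ ∈ Y → know C φ ∈ Y)
    (hneg : Provable p₀ (imp (neg φ) (know C (neg φ)))) (l : Path A P) :
    φ ∈ label p₀ X (origin C l) ↔ φ ∈ label p₀ X l := by
  induction l with
  | nil => rfl
  | cons e l ih =>
      obtain ⟨D, Y, n⟩ := e
      by_cases h : C ⊆ D
      · have hl := isMaximalConsistent_label hX l
        have hl' := isMaximalConsistent_label hX ((D, Y, n) :: l)
        have hsub := know_subset_label_cons hX D Y n l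
        rw [origin, if_pos h, ih]
        constructor
        · exact fun hφ => hsub (hl.know_mono h (hpos _ hl hφ))
        · intro hφ
          by_contra hn
          exact (hl'.neg_mem_iff _).1
            (hsub (hl.know_mono h (hl.mp hneg ((hl.neg_mem_iff _).2 hn)))) hφ
      · rw [origin, if_neg h]

theorem know_mem_label_iff (hX : IsMaximalConsistent p₀ X) {C : Set A} {φ : Formula A P}
    {l m : Path A P} (h : ∀ a ∈ C, origin {a} l = origin {a} m) :
    know C φ ∈ label p₀ X l ↔ know C φ ∈ label p₀ X m := by
  have key := mem_label_origin hX (C := C) (φ := know C φ)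
    (fun Y hY => hY.know_know) (.negative_introspection _ _)
  rw [← key, origin_eq_of_forall h, key]

theorem knowHow_mem_label_iff (hX : IsMaximalConsistent p₀ X) {C : Set A} {φ : Formula A P}
    {l m : Path A P} (h : ∀ a ∈ C, origin {a} l = origin {a} m) :
    knowHow C φ ∈ label p₀ X l ↔ knowHow C φ ∈ label p₀ X m := by
  have key := mem_label_origin hX (C := C) (φ := knowHow C φ)
    (fun Y hY => hY.know_knowHow) (.strategic_negative_introspection _ _)
  rw [← key, origin_eq_of_forall h, key]

theorem origin_cons_of_mem {C : Set A} {a : A} (ha : a ∈ C) (Y : Set (Formula A P)) (n : ℕ)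
    (l : Path A P) : origin {a} ((C, Y, n) :: l) = origin {a} l := by
  simp [origin, ha]

end Path

/-! ### The canonical model and the truth lemma -/

open KnowHow.Path

/-- The transitions of the canonical model. A choice is a formula to vote for, with a tag that names
the state at which the vote is cast; know-how takes effect whatever the tag. -/
def canonicalMechanism (p₀ : P) (X : Set (Formula A P)) :
    Set (Path A P × (A → Formula A P × ℕ) × Path A P) :=
  {r | (∀ ψ, strat {a | r.2.1 a = (ψ, tag r.1)} ψ ∈ label p₀ X r.1 → ψ ∈ label p₀ X r.2.2) ∧
    ∀ ψ, knowHow {a | (r.2.1 a).1 = ψ} ψ ∈ label p₀ X r.1 → ψ ∈ label p₀ X r.2.2}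

/-- Serves both totality and the truth lemma for `strat`. The target ignores tags, hence satisfies
more than the mechanism asks. Its edge may carry `∅`, since whatever `∅` knows is forced by `strat
∅`, by Empty Coalition and Strategic Truth. -/
theorem exists_canonicalMechanism {X : Set (Formula A P)} (hX : IsMaximalConsistent p₀ X)
    {C : Coalition A} {φ : Formula A P} {l : Path A P} (h : strat C φ ∉ label p₀ X l)
    (g : A → Formula A P × ℕ) (hg : ∀ a ∉ C, Provable p₀ (g a).1) :
    ∃ m, (l, g, m) ∈ canonicalMechanism p₀ X ∧ φ ∉ label p₀ X m := by
  have hl := isMaximalConsistent_label hX l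
  obtain ⟨Y, hY, hlY, hφ⟩ := hl.exists_of_strat_notMem h (fun a => (g a).1) hg
  have hm : label p₀ X ((∅, Y, 0) :: l) = Y := label_cons hY fun χ hχ => hlY χ <|
    (isCooperative_strat p₀).mono hl (Set.empty_subset _)
      (hl.strat_of_knowHow (hl.mp (.empty_coalition _) hχ))
  refine ⟨(∅, Y, 0) :: l, ⟨fun ψ hψ => ?_, fun ψ hψ => ?_⟩, by rwa [hm]⟩
  · rw [hm]
    refine hlY ψ ((isCooperative_strat p₀).mono hl (fun a ha => ?_) hψ)
    exact congrArg Prod.fst ha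
  · rw [hm]
    exact hlY ψ (hl.strat_of_knowHow hψ)

/-- The canonical model, rooted at a maximal consistent set. -/
noncomputable def canonicalModel {X : Set (Formula A P)} (hX : IsMaximalConsistent p₀ X) :
    TransitionSystem A P where
  W := Path A P
  indist a l m := origin {a} l = origin {a} m
  indist_equivalence _ := ⟨fun _ => rfl, Eq.symm, Eq.trans⟩
  V := Formula A P × ℕ
  nonempty_V := ⟨(var p₀, 0)⟩
  M := canonicalMechanism p₀ X
  total l g := by
    have hl := isMaximalConsistent_label hX l
    -- With `C` the set of all agents the votes `g` are unrestricted, and Nontermination supplies a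
    -- formula that `C` cannot force.
    obtain ⟨m, hm, -⟩ := exists_canonicalMechanism hX (C := Set.univ) (l := l)
      ((hl.neg_mem_iff _).1 (hl.of_provable (.nontermination Set.univ))) g
      (fun a ha => (ha trivial).elim)
    exact ⟨m, hm⟩
  val p := {l | var p ∈ label p₀ X l}

/-- Agents outside `C` vote for a tautology, so their votes add nothing. -/
theorem exists_extension {C : Set A} (p₀ : P) (f : {a : A // a ∈ C} → Formula A P × ℕ) :
    ∃ g : A → Formula A P × ℕ, (∀ a : {a : A // a ∈ C}, g a.1 = f a) ∧
      ∀ a ∉ C, Provable p₀ (g a).1 := by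
  classical
  refine ⟨fun a => if h : a ∈ C then f ⟨a, h⟩ else (imp (var p₀) (var p₀), 0),
    fun a => by simp [a.2], fun a ha => ?_⟩
  simp only [dif_neg ha]
  exact provable_imp_self _ _

/-- The truth lemma. -/
theorem sat_canonicalModel_iff [Finite A] {X : Set (Formula A P)}
    (hX : IsMaximalConsistent p₀ X) (φ : Formula A P) (l : Path A P) :
    (canonicalModel hX).Sat l φ ↔ φ ∈ label p₀ X l := by
  induction φ generalizing l with
  | var p => rfl
  | neg φ ih =>
      rw [(isMaximalConsistent_label hX l).neg_mem_iff, ← ih]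
      rfl
  | imp φ ψ ihφ ihψ =>
      rw [(isMaximalConsistent_label hX l).imp_mem_iff, ← ihφ, ← ihψ]
      rfl
  | know C φ ih =>
      have hl := isMaximalConsistent_label hX l
      constructor
      · intro h
        by_contra hn
        obtain ⟨Y, hY, hlY, hφ⟩ := hl.exists_of_know_notMem hn
        have := (ih _).1 (h ((C, Y, 0) :: l) fun a ha => (origin_cons_of_mem ha Y 0 l).symm)
        rw [label_cons hY hlY] at this
        exact hφ this
      · intro h m hlm
        exact (ih m).2 ((isMaximalConsistent_label hX m).mp (.truth _ _)
          ((know_mem_label_iff hX hlm).1 h))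
  | strat C φ ih =>
      have hl := isMaximalConsistent_label hX l
      constructor
      · rintro ⟨f, hf⟩
        by_contra hn
        obtain ⟨g, hgf, hg⟩ := exists_extension p₀ f
        obtain ⟨m, hm, hφ⟩ := exists_canonicalMechanism hX hn g hg
        exact hφ ((ih m).1 (hf m ⟨g, hgf, hm⟩))
      · intro h
        refine ⟨fun _ => (φ, tag l), fun m hm => (ih m).2 ?_⟩
        obtain ⟨g, hg, hm⟩ := hm
        exact hm.1 φ ((isCooperative_strat p₀).mono hl (fun a ha => hg ⟨a, ha⟩) h)
  | knowHow C φ ih =>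
      have hl := isMaximalConsistent_label hX l
      constructor
      · rintro ⟨f, hf⟩
        by_contra hn
        obtain ⟨g, hgf, hg⟩ := exists_extension p₀ f
        obtain ⟨X', Y, hX', hY, hlX', hS, hH, hφ⟩ :=
          hl.exists_of_knowHow_notMem hn (fun a => (g a).1) hg
        -- Finitely many agents name finitely many tags, so some tag `n` is named by nobody. At a
        -- state tagged `n` no nonempty coalition can act through `strat`.
        obtain ⟨n, hn⟩ := (Set.finite_range fun a => (g a).2).exists_notMem
        have hm : label p₀ X ((C, X', n) :: l) = X' := label_cons hX' hlX'
        have hr : label p₀ X ((∅, Y, 0) :: (C, X', n) :: l) = Y := by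
          refine label_cons hY fun χ hχ => hS χ ?_
          rw [hm] at hχ
          exact hX'.strat_of_knowHow (hX'.mp (.empty_coalition _) hχ)
        have hM : ((C, X', n) :: l, g, (∅, Y, 0) :: (C, X', n) :: l) ∈
            canonicalMechanism p₀ X := by
          refine ⟨fun ψ hψ => ?_, fun ψ hψ => ?_⟩
          · rw [hr]
            rw [hm] at hψ
            have he : {a | g a = (ψ, tag ((C, X', n) :: l))} = ∅ :=
              Set.eq_empty_iff_forall_notMem.2 fun a ha => hn ⟨a, congrArg Prod.snd ha⟩
            exact hS ψ (by simpa only [he] using hψ)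
          · rw [hr]
            rw [hm] at hψ
            exact hH ψ hψ
        have := (ih _).1 (hf ((C, X', n) :: l) _
          (fun a ha => (origin_cons_of_mem ha X' n l).symm) ⟨g, hgf, hM⟩)
        rw [hr] at this
        exact hφ this
      · intro h
        -- The tag is arbitrary, as know-how ignores tags; this makes one profile work at all states
        -- that `C` confuses.
        refine ⟨fun _ => (φ, 0), fun m r hlm hr => (ih r).2 ?_⟩
        obtain ⟨g, hg, hM⟩ := hr
        refine hM.2 φ ((isCooperative_knowHow p₀).mono (isMaximalConsistent_label hX m)
          (fun a ha => congrArg Prod.fst (hg ⟨a, ha⟩)) ((knowHow_mem_label_iff hX hlm).1 h))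

end CanonicalModel

/-! ### Transfer to arbitrary universes -/

section Universes

variable {A : Type u} {P : Type v}

/-- Stage `S n` holds the formulas of nesting depth below `n`; it is countable since there are only
finitely many coalitions. Countability makes the canonical model small in every universe. -/
instance [Finite A] [Countable P] : Countable (Formula A P) := by
  let S : ℕ → Set (Formula A P) := fun n => Nat.rec ∅ (fun _ s =>
    Set.range var ∪ neg '' s ∪ Set.image2 imp s s ∪ Set.image2 know Set.univ s ∪
      Set.image2 strat Set.univ s ∪ Set.image2 knowHow Set.univ s) n
  have hS : ∀ n, (S n).Countable := by
    intro n
    induction n with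
    | zero => exact Set.countable_empty
    | succ n ih =>
        have hU : (Set.univ : Set (Set A)).Countable := Set.countable_univ
        exact (((((Set.countable_range _).union (ih.image _)).union (ih.image2 ih _)).union
          (hU.image2 ih _)).union (hU.image2 ih _)).union (hU.image2 ih _)
  have hmono : Monotone S := by
    refine monotone_nat_of_le_succ fun n => ?_
    induction n with
    | zero => exact Set.empty_subset _
    | succ n ih =>
        change Set.range var ∪ neg '' S n ∪ Set.image2 imp (S n) (S n) ∪
          Set.image2 know Set.univ (S n) ∪ Set.image2 strat Set.univ (S n) ∪
          Set.image2 knowHow Set.univ (S n) ⊆ Set.range var ∪ neg '' S (n + 1) ∪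
          Set.image2 imp (S (n + 1)) (S (n + 1)) ∪ Set.image2 know Set.univ (S (n + 1)) ∪
          Set.image2 strat Set.univ (S (n + 1)) ∪ Set.image2 knowHow Set.univ (S (n + 1))
        have ih' : S n ⊆ S (n + 1) := ih
        gcongr
  have hmem : ∀ φ, ∃ n, φ ∈ S n := by
    intro φ
    induction φ with
    | var p => exact ⟨1, .inl (.inl (.inl (.inl (.inl ⟨p, rfl⟩))))⟩
    | neg φ ih =>
        obtain ⟨n, hn⟩ := ih
        exact ⟨n + 1, .inl (.inl (.inl (.inl (.inr ⟨φ, hn, rfl⟩))))⟩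
    | imp φ ψ ihφ ihψ =>
        obtain ⟨n, hn⟩ := ihφ
        obtain ⟨m, hm⟩ := ihψ
        exact ⟨max n m + 1, .inl (.inl (.inl (.inr ⟨φ, hmono (le_max_left _ _) hn, ψ,
          hmono (le_max_right _ _) hm, rfl⟩)))⟩
    | know C φ ih =>
        obtain ⟨n, hn⟩ := ih
        exact ⟨n + 1, .inl (.inl (.inr ⟨C, trivial, φ, hn, rfl⟩))⟩
    | strat C φ ih =>
        obtain ⟨n, hn⟩ := ih
        exact ⟨n + 1, .inl (.inr ⟨C, trivial, φ, hn, rfl⟩)⟩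
    | knowHow C φ ih =>
        obtain ⟨n, hn⟩ := ih
        exact ⟨n + 1, .inr ⟨C, trivial, φ, hn, rfl⟩⟩
  rw [← Set.countable_univ_iff]
  exact (Set.countable_iUnion hS).mono fun φ _ => Set.mem_iUnion.2 (hmem φ)

namespace TransitionSystem

universe w' x'

/-- Isomorphisms of transition systems, possibly in different universes. -/
structure Iso (T : TransitionSystem.{u, v, w, x} A P)
    (T' : TransitionSystem.{u, v, w', x'} A P) where
  /-- the bijection of states -/
  state : T.W ≃ T'.W
  /-- the bijection of choices -/
  choice : T.V ≃ T'.V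
  indist_iff : ∀ a s t, T'.indist a (state s) (state t) ↔ T.indist a s t
  mem_M_iff : ∀ s g t, (state s, choice ∘ g, state t) ∈ T'.M ↔ (s, g, t) ∈ T.M
  mem_val_iff : ∀ p s, state s ∈ T'.val p ↔ s ∈ T.val p

namespace Iso

variable {T : TransitionSystem.{u, v, w, x} A P} {T' : TransitionSystem.{u, v, w', x'} A P}
  (i : T.Iso T')

theorem step_iff {C : Coalition A} (f : T.Profile C) (s t : T.W) :
    T'.Step (fun a => i.choice (f a)) (i.state s) (i.state t) ↔ T.Step f s t := by
  constructor
  · rintro ⟨g, hg, hM⟩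
    have hcomp : i.choice ∘ (i.choice.symm ∘ g) = g := by
      ext a
      exact i.choice.apply_symm_apply _
    refine ⟨i.choice.symm ∘ g, fun a => ?_, (i.mem_M_iff _ _ _).1 (by rwa [hcomp])⟩
    rw [Function.comp_apply, hg a, Equiv.symm_apply_apply]
  · rintro ⟨g, hg, hM⟩
    exact ⟨i.choice ∘ g, fun a => congrArg i.choice (hg a), (i.mem_M_iff _ _ _).2 hM⟩

theorem coalIndist_iff (C : Coalition A) (s t : T.W) :
    T'.CoalIndist C (i.state s) (i.state t) ↔ T.CoalIndist C s t := by
  simp only [CoalIndist, i.indist_iff]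

theorem exists_profile {C : Coalition A} (f : T'.Profile C) :
    ∃ f' : T.Profile C, (fun a => i.choice (f' a)) = f :=
  ⟨fun a => i.choice.symm (f a), funext fun _ => i.choice.apply_symm_apply _⟩

theorem sat_iff (φ : Formula A P) (s : T.W) : T'.Sat (i.state s) φ ↔ T.Sat s φ := by
  induction φ generalizing s with
  | var p => exact i.mem_val_iff p s
  | neg φ ih => simp only [Sat, ih]
  | imp φ ψ ihφ ihψ => simp only [Sat, ihφ, ihψ]
  | know C φ ih => simp only [Sat, i.state.surjective.forall, i.coalIndist_iff, ih]
  | strat C φ ih =>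
      have hf : Function.Surjective fun (f : T.Profile C) a => i.choice (f a) := i.exists_profile
      simp only [Sat, hf.exists, i.state.surjective.forall, i.step_iff, ih]
  | knowHow C φ ih =>
      have hf : Function.Surjective fun (f : T.Profile C) a => i.choice (f a) := i.exists_profile
      simp only [Sat, hf.exists, i.state.surjective.forall, i.step_iff, i.coalIndist_iff, ih]

end Iso

/-- Transport of a transition system along bijections of its states and of its choices. -/
def transport (T : TransitionSystem.{u, v, w, x} A P) {W : Type w'} {V : Type x'}
    (e : T.W ≃ W) (d : T.V ≃ V) : TransitionSystem.{u, v, w', x'} A P where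
  W := W
  indist a s t := T.indist a (e.symm s) (e.symm t)
  indist_equivalence a := (T.indist_equivalence a).comap e.symm
  V := V
  nonempty_V := T.nonempty_V.map d
  M := {r | (e.symm r.1, d.symm ∘ r.2.1, e.symm r.2.2) ∈ T.M}
  total s f := by
    obtain ⟨t, ht⟩ := T.total (e.symm s) (d.symm ∘ f)
    exact ⟨e t, by simpa using ht⟩
  val p := e.symm ⁻¹' T.val p

/-- A transition system is isomorphic to its transports. -/
def isoTransport (T : TransitionSystem.{u, v, w, x} A P) {W : Type w'} {V : Type x'}
    (e : T.W ≃ W) (d : T.V ≃ V) : T.Iso (T.transport e d) where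
  state := e
  choice := d
  indist_iff a s t := by
    change T.indist a (e.symm (e s)) (e.symm (e t)) ↔ _
    simp only [Equiv.symm_apply_apply]
  mem_M_iff s g t := by
    change (e.symm (e s), d.symm ∘ (d ∘ g), e.symm (e t)) ∈ T.M ↔ _
    simp only [Equiv.symm_apply_apply, ← Function.comp_assoc, Equiv.symm_comp_self,
      Function.id_comp]
  mem_val_iff p s := by
    change e.symm (e s) ∈ T.val p ↔ _
    rw [Equiv.symm_apply_apply]

end TransitionSystem

theorem provable_of_valid [Finite A] [Countable P] {p₀ : P} {φ : Formula A P}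
    (h : ∀ (T : TransitionSystem.{u, v, w, x} A P) (s : T.W), T.Sat s φ) : Provable p₀ φ := by
  by_contra hn
  obtain ⟨X, hX, -, hφ⟩ := exists_isMaximalConsistent (p₀ := p₀) (Γ := ∅) (φ := φ)
    (mt Derives.provable hn)
  -- The hypothesis concerns models in the universes `w` and `x`, so a copy of the canonical model
  -- is placed there.
  let i := (canonicalModel hX).isoTransport (equivShrink.{w} (Path A P))
    (equivShrink.{x} (Formula A P × ℕ))
  exact hφ ((sat_canonicalModel_iff hX φ []).1 ((i.sat_iff φ []).1 (h _ _)))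

end Universes

end KnowHow

theorem mainTheorem1 {A : Type u} [Finite A] {P : Type v} [Countable P] (p₀ : P)
    (φ : KnowHow.Formula A P) :
    KnowHow.Provable p₀ φ ↔
      ∀ (T : KnowHow.TransitionSystem.{u, v, w, x} A P) (s : T.W), T.Sat s φ :=
  ⟨fun h => h.sound, KnowHow.provable_of_valid⟩
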